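/- All rings are commutative with $1$. For a ring $A$, let $\mathrm{Q}(A)$ be its total ring of fractions and $\overline{A}$ the integral closure of $A$ in $\mathrm{Q}(A)$. Put $$A^{*}=\{\alpha\in\overline{A}\mid \alpha\otimes 1=1\otimes\alpha \text{ in } \overline{A}\otimes_A\overline{A}\},$$ a subring of $\overline{A}$ containing $A$ (the strict closure of $A$ in $\overline{A}$); $A$ is called strictly closed if $A=A^{*}$. Let $\varphi: R\to S$ be a faithfully flat homomorphism of Noetherian rings. Assume that for each homomorphism $R\to R'$ of rings such that $R'$ is a finitely generated $R$-module, the local ring $$[S\otimes_R R']_P/\mathfrak p[S\otimes_R R']_P$$ is regular for every $P\in\operatorname{Spec}(S\otimes_R R')$, where $\mathfrak p=P\cap R'$ is the preimage of $P$ in $R'$. Suppose that $R$ is reduced and that $\overline{R}$ is a finitely generated $R$-module. Let $\beta: S\otimes_R\mathrm{Q}(R)\to\mathrm{Q}(S)$ be the canonical map $s\otimes x\mapsto s\,x$; it is injective. Then the following assertions hold, where, for an $R$-submodule $M$ of $\mathrm{Q}(R)$, $S\otimes_R M$ is regarded as a submodule of $S\otimes_R\mathrm{Q}(R)$ by flatness: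 1. $S$ is reduced. 2. $\beta(S\otimes_R\overline{R})=\overline{S}$ in $\mathrm{Q}(S)$. 3. $\beta(S\otimes_R R^{*})=S^{*}$ in $\mathrm{Q}(S)$. 4. $R$ is strictly closed if and only if $S$ is strictly closed. -/

import Mathlib

open scoped TensorProduct nonZeroDivisors

universe u v

noncomputable section

/-- The strict closure of `R` in an extension `A`: the `R`-subalgebra of those `α : A` with
`α ⊗ 1 = 1 ⊗ α` in `A ⊗[R] A`. -/
def strictClosureIn (R A : Type*) [CommRing R] [CommRing A] [Algebra R A] : Subalgebra R A :=
  AlgHom.equalizer (Algebra.TensorProduct.includeLeft : A →ₐ[R] A ⊗[R] A)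
    (Algebra.TensorProduct.includeRight : A →ₐ[R] A ⊗[R] A)

theorem mem_strictClosureIn_iff {R A : Type*} [CommRing R] [CommRing A] [Algebra R A] (α : A) :
    α ∈ strictClosureIn R A ↔ α ⊗ₜ[R] (1 : A) = (1 : A) ⊗ₜ[R] α :=
  Iff.rfl

/-- `R` is strictly closed in `A`: the strict closure of `R` in `A` is the image of `R`. -/
def IsStrictlyClosedIn (R A : Type*) [CommRing R] [CommRing A] [Algebra R A] : Prop :=
  strictClosureIn R A = ⊥

/-- The integral closure of `R` in its total ring of fractions. -/
abbrev normalization (R : Type*) [CommRing R] : Subalgebra R (FractionRing R) :=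
  integralClosure R (FractionRing R)

/-- The strict closure of `R` in its normalization, viewed inside the total ring of fractions. -/
def strictClosure (R : Type*) [CommRing R] : Subalgebra R (FractionRing R) :=
  (strictClosureIn R (normalization R)).map (normalization R).val

/-- `R` is strictly closed: it is strictly closed in its normalization. -/
def IsStrictlyClosed (R : Type*) [CommRing R] : Prop :=
  IsStrictlyClosedIn R (normalization R)

/-- A flat algebra map sends non-zero-divisors to non-zero-divisors. -/
theorem nonZeroDivisors_le_comap_of_flat (R S : Type*) [CommRing R] [CommRing S] [Algebra R S]
    [Module.Flat R S] : R⁰ ≤ S⁰.comap (algebraMap R S) := by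
  intro r hr
  have h : IsSMulRegular S r := Module.Flat.isSMulRegular_of_nonZeroDivisors hr
  rw [Submonoid.mem_comap, mem_nonZeroDivisors_iff_right]
  intro x hx
  refine h ?_
  simpa [Algebra.smul_def, mul_comm] using hx

/-- The map `Q(R) → Q(S)`, `a / b ↦ a / b`, of total rings of fractions induced by a flat
algebra `R → S`. -/
def fractionRingMap (R S : Type*) [CommRing R] [CommRing S] [Algebra R S] [Module.Flat R S] :
    FractionRing R →ₐ[R] FractionRing S where
  toRingHom := IsLocalization.map (FractionRing S) (algebraMap R S)
    (nonZeroDivisors_le_comap_of_flat R S)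
  commutes' r := by
    simp [IsScalarTower.algebraMap_apply R S (FractionRing S)]

/-- The canonical map `S ⊗[R] Q(R) → Q(S)`, `s ⊗ x ↦ s * x`. -/
def tensorFractionRingMap (R S : Type*) [CommRing R] [CommRing S] [Algebra R S]
    [Module.Flat R S] : S ⊗[R] FractionRing R →ₐ[S] FractionRing S :=
  Algebra.TensorProduct.lift (Algebra.ofId S (FractionRing S)) (fractionRingMap R S)
    fun _ _ => Commute.all _ _

/-- The local fibre `B_P / 𝔭 B_P` of a ring map `f : A → B` at a prime `P` of `B`, where
`𝔭 = P ∩ A` is the preimage of `P` under `f`. -/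
abbrev LocalFibre {A B : Type*} [CommRing A] [CommRing B] (f : A →+* B)
    (P : Ideal B) [P.IsPrime] : Type _ :=
  Localization.AtPrime P ⧸
    (P.comap f).map ((algebraMap B (Localization.AtPrime P)).comp f)

end

/-! Write `A` for the normalization of `R` and `B = S ⊗[R] A`. By flatness `B` embeds in `Q(S)`, and
it is integral over `S`; so `B` is the normalization of `S` once it is integrally closed there. As
`A` is finite over `R`, the fibres of `A → B` are regular.

If `b / s` is integral over `B` but `s ∤ b`, some associated prime `P` of `B ⧸ (s)` contains `(s :
b)`. `B_P` is then a discrete valuation ring (`isDomain_and_isPrincipal_localization`), hence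
contains `b / s`, which is absurd. To see this, let `p = P ∩ A`. If `p` has no regular element,
`B_P` equals its fibre, a regular ring of depth one. Otherwise flatness makes `p` of depth one,
normality of `A` makes `p` locally principal (`exists_locally_principal`), and its generator is a
regular prime element of `B_P`, as regular local rings are domains; depth one forces it to generate
the maximal ideal.

The strict closure is the kernel of `α ↦ α ⊗ 1 - 1 ⊗ α`, so it commutes with flat base change;
faithful flatness descends the equality with the base ring. -/

open IsLocalRing

/-! ### Regular local rings -/

/-- A prime ideal contained in a principal prime ideal `(x)` of a Noetherian local ring, and
not containing `x`, is zero. -/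
theorem Ideal.eq_bot_of_le_span_singleton_of_notMem {R : Type*} [CommRing R] [IsLocalRing R]
    [IsNoetherianRing R] {x : R} (hx : x ∈ maximalIdeal R) {q : Ideal R} [hq : q.IsPrime]
    (hqx : q ≤ Ideal.span {x}) (hxq : x ∉ q) : q = ⊥ := by
  refine Submodule.eq_bot_of_le_smul_of_le_jacobson_bot (Ideal.span {x}) q
    (IsNoetherian.noetherian q) ?_ ?_
  · intro y hy
    obtain ⟨z, rfl⟩ := Ideal.mem_span_singleton.1 (hqx hy)
    exact Submodule.smul_mem_smul (Ideal.mem_span_singleton_self x)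
      ((hq.mem_or_mem hy).resolve_left hxq)
  · rw [IsLocalRing.jacobson_eq_maximalIdeal _ bot_ne_top]
    exact (Ideal.span_singleton_le_iff_mem _).2 hx

/-- A Noetherian local ring in which some nonunit outside the minimal primes generates a prime
ideal is a domain. -/
theorem isDomain_of_isPrime_span_singleton {R : Type*} [CommRing R] [IsLocalRing R]
    [IsNoetherianRing R] {x : R} (hx : x ∈ maximalIdeal R)
    (hxmin : ∀ q ∈ minimalPrimes R, x ∉ q) (hprime : (Ideal.span {x}).IsPrime) : IsDomain R := by
  obtain ⟨q, hq, hqx⟩ := Ideal.exists_minimalPrimes_le (I := ⊥) (J := Ideal.span {x}) bot_le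
  have := hq.1.1
  have h := Ideal.eq_bot_of_le_span_singleton_of_notMem hx hqx (hxmin q hq)
  subst h
  exact IsDomain.of_bot_isPrime R

/-- If `x` lies in the maximal ideal but not in its square, then the maximal ideal of the quotient
by `x` needs one generator less. -/
theorem spanFinrank_maximalIdeal_quotient_lt {R : Type*} [CommRing R] [IsLocalRing R]
    [IsNoetherianRing R] {x : R} (hx : x ∈ maximalIdeal R) (hx2 : x ∉ maximalIdeal R ^ 2)
    [IsLocalRing (R ⧸ Ideal.span {x})] :
    (maximalIdeal (R ⧸ Ideal.span {x})).spanFinrank < (maximalIdeal R).spanFinrank := by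
  classical
  have hfg : (maximalIdeal R).FG := IsNoetherian.noetherian _
  have hfin := Submodule.FG.finite_generators hfg
  set G := (maximalIdeal R).generators with hG
  have hspan : Ideal.span G = maximalIdeal R := (maximalIdeal R).span_generators
  -- Since `x` is not in the square of the maximal ideal, some generator has a unit coefficient in
  -- `x`; `x` can replace it.
  obtain ⟨g, hgG, hg⟩ : ∃ g ∈ G, g ∈ Ideal.span (insert x (G \ {g})) := by
    have hxs : x ∈ Ideal.span G := hspan ▸ hx
    obtain ⟨c, hcs, hc⟩ := (Submodule.mem_span_set (R := R)).1 hxs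
    obtain ⟨g, hgc, hgu⟩ : ∃ g ∈ c.support, IsUnit (c g) := by
      by_contra! h
      apply hx2
      rw [← hc, pow_two]
      refine Ideal.sum_mem _ fun g hgc => ?_
      exact Ideal.mul_mem_mul ((mem_maximalIdeal _).2 (h g hgc)) (hspan ▸ Ideal.subset_span (hcs hgc))
    refine ⟨g, hcs hgc, ?_⟩
    rw [Finsupp.sum, ← Finset.add_sum_erase _ _ hgc] at hc
    obtain ⟨v, hv⟩ := hgu.exists_left_inv
    have : g = v * (x - ∑ y ∈ c.support.erase g, c y • y) := by
      rw [← hc, add_sub_cancel_right, smul_eq_mul, ← mul_assoc, hv, one_mul]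
    refine (congrArg (· ∈ Ideal.span (insert x (G \ {g}))) this).mpr ?_
    refine Ideal.mul_mem_left _ _ (sub_mem (Ideal.subset_span (by simp)) (Ideal.sum_mem _ ?_))
    intro y hy
    obtain ⟨h1, h2⟩ := Finset.mem_erase.1 hy
    exact Ideal.mul_mem_left _ _ (Ideal.subset_span (Or.inr ⟨hcs h2, h1⟩))
  have hmax : maximalIdeal (R ⧸ Ideal.span {x}) =
      Ideal.span (Ideal.Quotient.mk (Ideal.span {x}) '' (G \ {g})) := by
    have h1 : (maximalIdeal R).map (Ideal.Quotient.mk (Ideal.span {x})) =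
        maximalIdeal (R ⧸ Ideal.span {x}) := by
      refine (eq_maximalIdeal ?_)
      refine Ideal.map_eq_top_or_isMaximal_of_surjective _ Ideal.Quotient.mk_surjective
        (maximalIdeal.isMaximal R) |>.resolve_left ?_
      intro h
      have := (Ideal.comap_map_of_surjective' _ (Ideal.Quotient.mk_surjective (I := Ideal.span {x}))
        (maximalIdeal R))
      rw [h, Ideal.comap_top, Ideal.mk_ker, sup_eq_left.2
        ((Ideal.span_singleton_le_iff_mem _).2 hx)] at this
      exact (maximalIdeal.isMaximal R).ne_top this.symm
    rw [← h1, ← hspan]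
    apply le_antisymm
    · rw [Ideal.map_span, Ideal.span_le]
      rintro _ ⟨y, hy, rfl⟩
      have hy' : y ∈ Ideal.span (insert x (G \ {g})) := by
        by_cases h : y = g
        · exact h ▸ hg
        · exact Ideal.subset_span (Or.inr ⟨hy, h⟩)
      have := Ideal.mem_map_of_mem (Ideal.Quotient.mk (Ideal.span {x})) hy'
      rw [Ideal.map_span, Set.image_insert_eq,
        Ideal.Quotient.eq_zero_iff_mem.2 (Ideal.mem_span_singleton_self x),
        Ideal.span_insert_zero] at this
      exact this
    · rw [Ideal.map_span]
      exact Ideal.span_mono (Set.image_mono Set.sdiff_subset)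
  rw [hmax, ← Submodule.FG.generators_ncard hfg]
  calc _ ≤ (Ideal.Quotient.mk (Ideal.span {x}) '' (G \ {g})).ncard :=
        Submodule.spanFinrank_span_le_ncard_of_finite ((hfin.sdiff).image _)
    _ ≤ (G \ {g}).ncard := Set.ncard_image_le hfin.sdiff
    _ < G.ncard := Set.ncard_sdiff_singleton_lt_of_mem hgG hfin

/-- A regular local ring is a domain, and if it is not a field, then it has a nonzero principal
prime ideal. -/
theorem IsRegularLocalRing.isDomain_and_exists_prime (R : Type*) [CommRing R]
    [IsRegularLocalRing R] : IsDomain R ∧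
      (maximalIdeal R = ⊥ ∨ ∃ x ∈ maximalIdeal R, Prime x) := by
  classical
  induction hd : (maximalIdeal R).spanFinrank using Nat.strong_induction_on generalizing R with
  | _ d ih =>
  have hreg := (isRegularLocalRing_iff R).1 inferInstance
  by_cases hbot : maximalIdeal R = ⊥
  · exact ⟨(isField_iff_maximalIdeal_eq.2 hbot).isDomain, Or.inl hbot⟩
  have hmin : maximalIdeal R ∉ minimalPrimes R := by
    intro h
    have h0 : (maximalIdeal R).height = 0 := Ideal.height_eq_zero_iff.2 h
    rw [← maximalIdeal_height_eq_ringKrullDim, h0] at hreg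
    have : (maximalIdeal R).spanFinrank = 0 := by exact_mod_cast hreg
    exact hbot ((Submodule.spanFinrank_eq_zero_iff_eq_bot (IsNoetherian.noetherian _)).1 this)
  have hsq : maximalIdeal R ≠ maximalIdeal R ^ 2 := by
    intro h
    refine hbot (Submodule.eq_bot_of_le_smul_of_le_jacobson_bot (maximalIdeal R) _
      (IsNoetherian.noetherian _) ?_ (maximalIdeal_le_jacobson _))
    rw [smul_eq_mul, ← pow_two]
    exact h.le
  -- Prime avoidance, with the square of the maximal ideal as the one member allowed not to be
  -- prime.
  obtain ⟨x, hx, hxs⟩ : ∃ x ∈ maximalIdeal R, x ∉ ⋃ I ∈ insert (maximalIdeal R ^ 2)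
      (minimalPrimes R), (I : Set R) := by
    by_contra! h
    have hfin : (insert (maximalIdeal R ^ 2) (minimalPrimes R)).Finite :=
      (minimalPrimes.finite_of_isNoetherianRing R).insert _
    have htop : maximalIdeal R ^ 2 ≠ ⊤ := fun h => (maximalIdeal.isMaximal R).ne_top
      (top_le_iff.1 (h ▸ Ideal.pow_le_self two_ne_zero))
    rcases (Ideal.subset_iUnion_iff_mem_of_isMaximal_of_finite hfin
      (maximalIdeal R ^ 2) (maximalIdeal R ^ 2)
      (fun I hI h1 _ => (hI.resolve_left h1).1.1) htop htop).1 h with h | h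
    · exact hsq h
    · exact hmin h
  simp only [Set.mem_iUnion, Set.mem_insert_iff, not_exists] at hxs
  have hx2 : x ∉ maximalIdeal R ^ 2 := fun h => hxs _ (Or.inl rfl) h
  have hne : Ideal.span {x} ≠ ⊤ := fun h => (maximalIdeal.isMaximal R).ne_top
    (top_le_iff.1 (h ▸ (Ideal.span_singleton_le_iff_mem _).2 hx))
  have : Nontrivial (R ⧸ Ideal.span {x}) := Ideal.Quotient.nontrivial_iff.2 hne
  have : IsLocalRing (R ⧸ Ideal.span {x}) :=
    IsLocalRing.of_surjective' _ Ideal.Quotient.mk_surjective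
  have hlt := spanFinrank_maximalIdeal_quotient_lt hx hx2
  have : IsRegularLocalRing (R ⧸ Ideal.span {x}) := by
    apply IsRegularLocalRing.of_spanFinrank_maximalIdeal_le
    -- Dividing by `x` lowers the dimension by at most one and the number of generators by at least
    -- one.
    have h1 := ringKrullDim_le_ringKrullDim_quotient_add_encard {x}
      (by simpa [IsLocalRing.ringJacobson_eq_maximalIdeal] using hx)
    rw [← hreg, Set.encard_singleton] at h1
    obtain ⟨n, hn⟩ : ∃ n : ℕ, ringKrullDim (R ⧸ Ideal.span {x}) = n := by
      obtain ⟨n, hn⟩ := ENat.ne_top_iff_exists.1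
        (Ideal.height_ne_top (maximalIdeal.isMaximal (R ⧸ Ideal.span {x})).ne_top)
      exact ⟨n, by rw [← maximalIdeal_height_eq_ringKrullDim, ← hn]; rfl⟩
    rw [hn] at h1 ⊢
    have h2 : (maximalIdeal R).spanFinrank ≤ n + 1 := by exact_mod_cast h1
    have : (maximalIdeal (R ⧸ Ideal.span {x})).spanFinrank ≤ n := by omega
    exact_mod_cast this
  have hdom := (ih _ (hd ▸ hlt) (R ⧸ Ideal.span {x}) rfl).1
  have hp : (Ideal.span {x}).IsPrime := (Ideal.Quotient.isDomain_iff_prime _).1 hdom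
  refine ⟨isDomain_of_isPrime_span_singleton hx (fun q hq h => hxs _ (Or.inr hq) h) hp,
    Or.inr ⟨x, hx, (Ideal.span_singleton_prime ?_).1 hp⟩⟩
  rintro rfl
  exact hx2 (zero_mem _)

/-! ### Associated primes and prime avoidance -/

/-- In a Noetherian ring an element outside the principal ideal `(s)` gives rise to an associated
prime of `A ⧸ (s)` containing its annihilator. -/
theorem exists_isPrime_forall_mem_iff_dvd_mul {A : Type*} [CommRing A] [IsNoetherianRing A]
    {s b : A} (h : ¬ s ∣ b) :
    ∃ (P : Ideal A) (t : A), P.IsPrime ∧ ¬ s ∣ t ∧ (∀ a, a ∈ P ↔ s ∣ a * t) ∧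
      ∀ a, s ∣ a * b → a ∈ P := by
  have hb : Ideal.Quotient.mk (Ideal.span {s}) b ≠ 0 := by
    rwa [Ne, Ideal.Quotient.eq_zero_iff_mem, Ideal.mem_span_singleton]
  obtain ⟨P, hP, hbP⟩ := exists_le_isAssociatedPrime_of_isNoetherianRing A _ hb
  obtain ⟨hPp, t, rfl⟩ := isAssociatedPrime_iff.1 hP
  obtain ⟨t, rfl⟩ := Ideal.Quotient.mk_surjective t
  have hmem (a c : A) : a ∈ (⊥ : Submodule A (A ⧸ Ideal.span {s})).colon
      {Ideal.Quotient.mk (Ideal.span {s}) c} ↔ s ∣ a * c := by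
    rw [Submodule.mem_colon_singleton, Submodule.mem_bot, ← Ideal.mem_span_singleton,
      ← Ideal.Quotient.eq_zero_iff_mem, map_mul]
    rfl
  refine ⟨_, t, hPp, fun ht => ?_, fun a => hmem a t, fun a ha => hbP ((hmem a b).2 ha)⟩
  exact hPp.ne_top ((Ideal.eq_top_iff_one _).2 ((hmem 1 t).2 (by simpa using ht)))

/-- Prime avoidance for the associated primes of `A ⧸ (s)`. -/
theorem exists_regular_mod_or_exists_le {A : Type*} [CommRing A] [IsNoetherianRing A]
    (s : A) (p : Ideal A) : (∃ y ∈ p, ∀ a, s ∣ y * a → s ∣ a) ∨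
      ∃ (Q : Ideal A) (t : A), Q.IsPrime ∧ ¬ s ∣ t ∧ (∀ a, a ∈ Q ↔ s ∣ a * t) ∧ p ≤ Q := by
  refine or_iff_not_imp_left.2 fun h => ?_
  push Not at h
  have hsub : (p : Set A) ⊆ ⋃ Q ∈ associatedPrimes A (A ⧸ Ideal.span {s}), (Q : Set A) := by
    intro y hy
    obtain ⟨a, hya, ha⟩ := h y hy
    rw [biUnion_associatedPrimes_eq_zero_divisors]
    refine ⟨Ideal.Quotient.mk _ a, ?_, ?_⟩
    · rwa [Ne, Ideal.Quotient.eq_zero_iff_mem, Ideal.mem_span_singleton]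
    · rw [← Ideal.mem_span_singleton, ← Ideal.Quotient.eq_zero_iff_mem, map_mul] at hya
      exact hya
  obtain ⟨Q, hQ, hpQ⟩ := (Ideal.subset_union_prime_finite
    (associatedPrimes.finite A (A ⧸ Ideal.span {s})) ⊤ ⊤ (fun I hI _ _ => hI.1)).1 hsub
  obtain ⟨hQp, t, rfl⟩ := isAssociatedPrime_iff.1 hQ
  obtain ⟨t, rfl⟩ := Ideal.Quotient.mk_surjective t
  have hmem (a : A) : a ∈ (⊥ : Submodule A (A ⧸ Ideal.span {s})).colon
      {Ideal.Quotient.mk (Ideal.span {s}) t} ↔ s ∣ a * t := by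
    rw [Submodule.mem_colon_singleton, Submodule.mem_bot, ← Ideal.mem_span_singleton,
      ← Ideal.Quotient.eq_zero_iff_mem, map_mul]
    rfl
  refine ⟨_, t, hQp, fun ht => ?_, hmem, hpQ⟩
  exact hQp.ne_top ((Ideal.eq_top_iff_one _).2 ((hmem 1).2 (by simpa using ht)))

/-- A prime of a reduced Noetherian ring consisting of zero divisors vanishes locally. -/
theorem exists_notMem_mul_eq_zero {A : Type*} [CommRing A] [IsNoetherianRing A] [IsReduced A]
    {p : Ideal A} (hp : ∀ x ∈ p, x ∉ A⁰) : ∃ w ∉ p, ∀ q ∈ p, w * q = 0 := by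
  rcases exists_regular_mod_or_exists_le 0 p with ⟨y, hy, h⟩ | ⟨Q, t, hQ, ht, hQt, hpQ⟩
  · refine absurd (mem_nonZeroDivisors_iff_right.2 fun a ha => ?_) (hp y hy)
    exact zero_dvd_iff.1 (h a (zero_dvd_iff.2 (by rwa [mul_comm])))
  · simp only [zero_dvd_iff] at ht hQt
    -- If `t ∈ p`, then `t ^ 2 = 0`, because `p` annihilates `t`.
    refine ⟨t, fun htp => ht ?_, fun q hq => by rw [mul_comm]; exact (hQt q).1 (hpQ hq)⟩
    exact pow_eq_zero_iff two_ne_zero |>.1 (by rw [pow_two]; exact (hQt t).1 (hpQ htp))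

/-! ### Primes of depth one in a normal ring -/

/-- Let `A` be a Noetherian ring, integrally closed in its total ring of fractions. A prime of
`A` containing a non-zero-divisor `x` and no element regular modulo `x` is locally principal. -/
theorem exists_locally_principal {A : Type*} (K : Type*) [CommRing A] [CommRing K] [Algebra A K]
    [IsFractionRing A K] [IsIntegrallyClosedIn A K] [IsNoetherianRing A]
    {p : Ideal A} [hp : p.IsPrime] {x : A} (hx : x ∈ A⁰) (hxp : x ∈ p)
    (hreg : ∀ y ∈ p, ∃ a, x ∣ y * a ∧ ¬ x ∣ a) :
    ∃ c ∈ p, ∃ w ∉ p, ∀ q ∈ p, c ∣ w * q := by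
  obtain ⟨Q, t, hQ, ht, hQt, hpQ⟩ := (exists_regular_mod_or_exists_le x p).resolve_left (by
    rintro ⟨y, hy, h⟩
    obtain ⟨a, h1, h2⟩ := hreg y hy
    exact h2 (h a h1))
  have hcancel {a b : A} (h : x * a = x * b) : a = b := by
    rw [mul_comm x, mul_comm x] at h
    exact (mul_cancel_right_mem_nonZeroDivisors hx).1 h
  -- Put `z = t / x`, so `z Q ⊆ A`. If `z Q ⊆ Q`, all `x z ^ n` lie in `A`; then `z` is integral, so
  -- `z ∈ A`, against `¬ x ∣ t`. Hence `z c = w ∉ Q` for some `c ∈ Q`, and `c` generates `Q`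
  -- locally.
  obtain ⟨c, hc, w, hw, hcw⟩ : ∃ c ∈ Q, ∃ w ∉ Q, c * t = x * w := by
    by_contra! H
    set z : K := IsLocalization.mk' K t (⟨x, hx⟩ : A⁰) with hz
    have hzx : algebraMap A K x * z = algebraMap A K t := by
      rw [hz, mul_comm]; exact IsLocalization.mk'_spec K t (⟨x, hx⟩ : A⁰)
    have hxu : IsUnit (algebraMap A K x) := IsLocalization.map_units K (⟨x, hx⟩ : A⁰)
    have hpow (n : ℕ) : ∃ q ∈ Q, algebraMap A K x * z ^ n = algebraMap A K q := by
      induction n with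
      | zero => exact ⟨x, hpQ hxp, by simp⟩
      | succ n ih =>
        obtain ⟨q, hq, hqn⟩ := ih
        obtain ⟨a, ha⟩ := (hQt q).1 hq
        refine ⟨a, by_contra fun h => H q hq a h ha, hxu.mul_left_cancel ?_⟩
        rw [← map_mul, ← ha, map_mul, ← hzx, ← hqn]
        ring
    have hint : IsIntegral A z := by
      refine IsAlmostIntegral.isIntegral_of_nonZeroDivisors_le_comap ⟨x, hx, fun n => ?_⟩ ?_
      · obtain ⟨q, -, hq⟩ := hpow n
        exact ⟨q, by rw [Algebra.smul_def, hq]⟩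
      · intro y hy
        exact (IsLocalization.map_units K (⟨y, hy⟩ : A⁰)).mem_nonZeroDivisors
    obtain ⟨a, ha⟩ := IsIntegrallyClosedIn.algebraMap_eq_of_integral hint
    refine ht ⟨a, IsFractionRing.injective A K ?_⟩
    rw [← hzx, ← ha, map_mul]
  have key (q : A) (hq : q ∈ Q) : ∃ a, w * q = c * a := by
    obtain ⟨a, ha⟩ := (hQt q).1 hq
    refine ⟨a, hcancel ?_⟩
    rw [← mul_assoc, ← hcw, mul_assoc, mul_comm t, ha]
    ring
  have hwp : w ∉ p := fun h => hw (hpQ h)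
  by_cases hcp : c ∈ p
  · exact ⟨c, hcp, w, hwp, fun q hq => key q (hpQ hq)⟩
  -- If `c ∉ p`, each `w q = c a` has `a ∈ p`, so `p` equals `c p` in `A_Q` and vanishes there by
  -- Nakayama, although it contains the regular `x`.
  · exfalso
    have hbot : p.map (algebraMap A (Localization.AtPrime Q)) = ⊥ := by
      refine Submodule.eq_bot_of_le_smul_of_le_jacobson_bot
        (maximalIdeal (Localization.AtPrime Q)) _ (IsNoetherian.noetherian _) ?_
        (maximalIdeal_le_jacobson _)
      rw [Ideal.map_le_iff_le_comap]
      intro q hq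
      obtain ⟨a, ha⟩ := key q (hpQ hq)
      have hap : a ∈ p := (hp.mem_or_mem (ha ▸ p.mul_mem_left w hq)).resolve_left hcp
      have hwu : IsUnit (algebraMap A (Localization.AtPrime Q) w) :=
        IsLocalization.map_units _ (⟨w, hw⟩ : Q.primeCompl)
      rw [Ideal.mem_comap, smul_eq_mul, ← Ideal.unit_mul_mem_iff_mem _ hwu, ← map_mul, ha,
        map_mul]
      exact Ideal.mul_mem_mul ((IsLocalization.AtPrime.to_map_mem_maximal_iff _ Q c).2 hc)
        (Ideal.mem_map_of_mem _ hap)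
    have hx0 : algebraMap A (Localization.AtPrime Q) x = 0 := by
      rw [← Ideal.mem_bot, ← hbot]
      exact Ideal.mem_map_of_mem _ hxp
    obtain ⟨m, hm⟩ := (IsLocalization.map_eq_zero_iff Q.primeCompl _ x).1 hx0
    exact m.2 ((mem_nonZeroDivisors_iff_right.1 hx m.1 hm) ▸ Q.zero_mem)

/-! ### Flatness and depth one -/

/-- Regularity of `y` modulo `x` is preserved by flat base change. -/
theorem dvd_of_dvd_mul_of_flat {A B : Type*} [CommRing A] [CommRing B] [Algebra A B]
    [Module.Flat A B] {x y : A} (h : ∀ a, x ∣ y * a → x ∣ a) {b : B}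
    (hb : algebraMap A B x ∣ algebraMap A B y * b) : algebraMap A B x ∣ b := by
  obtain ⟨c, hc⟩ := hb
  -- The equational criterion of flatness turns `y b = x c` into relations over `A`, where the
  -- hypothesis applies.
  have hrel : ∑ i, (![y, -x] : Fin 2 → A) i • (![b, c] : Fin 2 → B) i = 0 := by
    simp [Fin.sum_univ_two, Algebra.smul_def, hc]
  obtain ⟨k, a, z, h1, h2⟩ :=
    Module.Flat.isTrivialRelation_of_sum_smul_eq_zero (R := A) (M := B) hrel
  have hb : b = ∑ j, a 0 j • z j := h1 0
  rw [hb]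
  refine Finset.dvd_sum fun j _ => ?_
  have h3 := h2 j
  simp only [Fin.sum_univ_two, Matrix.cons_val_zero, Matrix.cons_val_one] at h3
  obtain ⟨d, hd⟩ := h (a 0 j) ⟨a 1 j, by linear_combination h3⟩
  rw [hd, Algebra.smul_def, map_mul, mul_assoc]
  exact dvd_mul_right _ _

/-- If an ideal `m` annihilates a nonzero element modulo the non-zero-divisor `s`, then it does so
modulo any non-zero-divisor it contains. -/
theorem exists_not_dvd_forall_dvd_mul {B : Type*} [CommRing B] {m : Ideal B} {s t x : B}
    (hs : s ∈ B⁰) (hx : x ∈ B⁰) (hxm : x ∈ m) (ht : ¬ s ∣ t) (hm : ∀ y ∈ m, s ∣ y * t) :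
    ∃ t', ¬ x ∣ t' ∧ ∀ y ∈ m, x ∣ y * t' := by
  -- `t'` is `x t / s`.
  obtain ⟨t', ht'⟩ := hm x hxm
  refine ⟨t', ?_, fun y hy => ?_⟩
  · rintro ⟨c, rfl⟩
    refine ht ⟨c, (mul_cancel_right_mem_nonZeroDivisors hx).1 ?_⟩
    linear_combination ht'
  · obtain ⟨c, hc⟩ := hm y hy
    refine ⟨c, (mul_cancel_right_mem_nonZeroDivisors hs).1 ?_⟩
    linear_combination (-y) * ht' + x * hc

/-- A Noetherian local ring of depth one with a principal prime ideal generated by a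
non-zero-divisor is a discrete valuation ring. -/
theorem isDomain_and_isPrincipal_of_isPrime_span {L : Type*} [CommRing L] [IsLocalRing L]
    [IsNoetherianRing L] {s t x : L} (hs : s ∈ L⁰) (ht : ¬ s ∣ t)
    (hm : ∀ y ∈ maximalIdeal L, s ∣ y * t) (hx : x ∈ L⁰) (hxm : x ∈ maximalIdeal L)
    (hprime : (Ideal.span {x}).IsPrime) : IsDomain L ∧ (maximalIdeal L).IsPrincipal := by
  refine ⟨isDomain_of_isPrime_span_singleton hxm (fun q hq hxq => ?_) hprime, x, ?_⟩
  · exact (Set.disjoint_left.1 (Ideal.disjoint_nonZeroDivisors_of_mem_minimalPrimes hq)) hxq hx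
  · obtain ⟨t', ht', h⟩ := exists_not_dvd_forall_dvd_mul hs hx hxm ht hm
    refine le_antisymm (fun y hy => ?_) ((Ideal.span_singleton_le_iff_mem _).2 hxm)
    exact (hprime.mem_or_mem (Ideal.mem_span_singleton.2 (h y hy))).resolve_right
      fun h => ht' (Ideal.mem_span_singleton.1 h)

/-! ### Reducedness and normality along regular fibres -/

section LocalFibre

variable {A B : Type*} [CommRing A] [CommRing B] [Algebra A B]

/-- If `p` vanishes locally, then the local fibre over `p` is the local ring itself. -/
theorem isRegularLocalRing_localization_of_mul_eq_zero {P : Ideal B} [P.IsPrime]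
    [IsRegularLocalRing (LocalFibre (algebraMap A B) P)] {w : A}
    (hw : w ∉ P.comap (algebraMap A B)) (h : ∀ q ∈ P.comap (algebraMap A B), w * q = 0) :
    IsRegularLocalRing (Localization.AtPrime P) := by
  have hbot : (P.comap (algebraMap A B)).map
      ((algebraMap B (Localization.AtPrime P)).comp (algebraMap A B)) = ⊥ := by
    rw [eq_bot_iff, Ideal.map_le_iff_le_comap]
    intro q hq
    have hwu : IsUnit (algebraMap B (Localization.AtPrime P) (algebraMap A B w)) :=
      IsLocalization.map_units _ (⟨_, hw⟩ : P.primeCompl)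
    rw [Ideal.mem_comap, Ideal.mem_bot, ← hwu.mul_right_eq_zero, RingHom.comp_apply, ← map_mul,
      ← map_mul, h q hq, map_zero, map_zero]
  exact IsRegularLocalRing.of_ringEquiv
    ((Ideal.quotEquivOfEq hbot).trans (RingEquiv.quotientBot (Localization.AtPrime P)))

variable [Module.Flat A B] [IsNoetherianRing A] [IsReduced A] [IsNoetherianRing B]

/-- A flat extension with regular local fibres of a reduced Noetherian ring is reduced. -/
theorem isReduced_of_isRegularLocalRing_localFibre
    (hfib : ∀ (P : Ideal B) [P.IsPrime], IsRegularLocalRing (LocalFibre (algebraMap A B) P)) :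
    IsReduced B := by
  refine ⟨fun b hb => by_contra fun hb0 => ?_⟩
  obtain ⟨P, t, hP, ht, hPt, hbP⟩ :=
    exists_isPrime_forall_mem_iff_dvd_mul (s := 0) (b := b) (by rwa [zero_dvd_iff])
  simp only [zero_dvd_iff] at ht hPt hbP
  -- A regular element of `A` stays regular in `B`, so it cannot lie in `P`, which annihilates `t ≠
  -- 0`.
  obtain ⟨w, hw, h⟩ := exists_notMem_mul_eq_zero (p := P.comap (algebraMap A B)) (by
    intro x hxp hx
    refine ht (mem_nonZeroDivisors_iff_right.1 (nonZeroDivisors_le_comap_of_flat A B hx) t ?_)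
    rw [mul_comm]
    exact (hPt _).1 hxp)
  have := hfib P
  have := isRegularLocalRing_localization_of_mul_eq_zero hw h
  have := (IsRegularLocalRing.isDomain_and_exists_prime (Localization.AtPrime P)).1
  have hz : algebraMap B (Localization.AtPrime P) b = 0 := (hb.map _).eq_zero
  obtain ⟨m, hm⟩ := (IsLocalization.map_eq_zero_iff P.primeCompl _ b).1 hz
  exact m.2 (hbP _ hm)

/-- The localization of `B` at an associated prime of `B ⧸ (s)`, `s` a non-zero-divisor, is a
discrete valuation ring, if `B` is flat with regular local fibres over a Noetherian reduced ring
which is integrally closed in its total ring of fractions. -/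
theorem isDomain_and_isPrincipal_localization (K : Type*) [CommRing K] [Algebra A K]
    [IsFractionRing A K] [IsIntegrallyClosedIn A K] {P : Ideal B} [P.IsPrime]
    [IsRegularLocalRing (LocalFibre (algebraMap A B) P)] {s t : B} (hs : s ∈ B⁰) (ht : ¬ s ∣ t)
    (hPt : ∀ a, a ∈ P ↔ s ∣ a * t) :
    IsDomain (Localization.AtPrime P) ∧ (maximalIdeal (Localization.AtPrime P)).IsPrincipal := by
  set ι := algebraMap B (Localization.AtPrime P) with hι
  have hreg {b : B} (hb : b ∈ B⁰) : ι b ∈ (Localization.AtPrime P)⁰ :=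
    nonZeroDivisors_le_comap_of_flat B (Localization.AtPrime P) hb
  have htL : ¬ ι s ∣ ι t := by
    rintro ⟨c, hc⟩
    obtain ⟨⟨d, m⟩, hd⟩ := IsLocalization.surj P.primeCompl c
    refine m.2 ((hPt m).2 ?_)
    have h1 : ι (m * t) = ι (s * d) := by
      rw [map_mul, map_mul, hc, hι, ← hd]; ring
    obtain ⟨n, hn⟩ := (IsLocalization.eq_iff_exists P.primeCompl _).1 h1
    -- Non-divisibility survives localization because `(s : t)` is the prime `P` itself.
    have h2 : (n : B) * m ∈ P := (hPt _).2 ⟨n * d, by linear_combination hn⟩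
    exact (hPt _).1 ((Ideal.IsPrime.mem_or_mem ‹_› h2).resolve_left n.2)
  have hm : ∀ y ∈ maximalIdeal (Localization.AtPrime P), ι s ∣ y * ι t := by
    intro y hy
    rw [← Ideal.mem_span_singleton]
    have : maximalIdeal (Localization.AtPrime P) ≤
        (Ideal.span {ι s}).colon (Ideal.span {ι t}) := by
      rw [← Localization.AtPrime.map_eq_maximalIdeal, Ideal.map_le_iff_le_comap]
      intro b hb
      rw [Ideal.mem_comap, Ideal.mem_colon_span_singleton, ← map_mul, Ideal.mem_span_singleton]
      exact map_dvd ι ((hPt b).1 hb)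
    exact Ideal.mem_colon_span_singleton.1 (this hy)
  set p := P.comap (algebraMap A B) with hp
  by_cases hpreg : ∀ x ∈ p, x ∉ A⁰
  · obtain ⟨w, hw, h⟩ := exists_notMem_mul_eq_zero hpreg
    have := isRegularLocalRing_localization_of_mul_eq_zero hw h
    obtain ⟨hdom, hmax | ⟨x, hx, hxp⟩⟩ :=
      IsRegularLocalRing.isDomain_and_exists_prime (Localization.AtPrime P)
    · exact ⟨hdom, hmax ▸ bot_isPrincipal⟩
    · exact isDomain_and_isPrincipal_of_isPrime_span (hreg hs) htL hm
        (mem_nonZeroDivisors_of_ne_zero hxp.ne_zero) hx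
        ((Ideal.span_singleton_prime hxp.ne_zero).2 hxp)
  · push Not at hpreg
    obtain ⟨x, hxp, hx⟩ := hpreg
    have hxB : algebraMap A B x ∈ B⁰ := nonZeroDivisors_le_comap_of_flat A B hx
    obtain ⟨t', ht', h⟩ := exists_not_dvd_forall_dvd_mul hs hxB (m := P) hxp ht
      fun y hy => (hPt y).1 hy
    -- If `y ∈ p` were regular modulo `x`, it would remain so in `B`, but `P` kills `t'` modulo `x`.
    obtain ⟨c, hc, w, hw, hcw⟩ := exists_locally_principal K hx hxp (p := p) (by
      intro y hy
      by_contra! H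
      exact ht' (dvd_of_dvd_mul_of_flat H (h _ hy)))
    have hwu : IsUnit (ι (algebraMap A B w)) :=
      IsLocalization.map_units _ (⟨_, hw⟩ : P.primeCompl)
    have hdvd : ∀ q ∈ p, ι (algebraMap A B c) ∣ ι (algebraMap A B q) := by
      intro q hq
      rw [← hwu.dvd_mul_left, ← map_mul, ← map_mul]
      exact map_dvd ι (map_dvd _ (hcw q hq))
    have hcreg : ι (algebraMap A B c) ∈ (Localization.AtPrime P)⁰ := by
      obtain ⟨d, hd⟩ := hdvd x hxp
      have := hreg hxB
      rw [hd] at this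
      exact (mul_mem_nonZeroDivisors.1 this).1
    have hspan : p.map (ι.comp (algebraMap A B)) = Ideal.span {ι (algebraMap A B c)} := by
      refine le_antisymm (Ideal.map_le_iff_le_comap.2 fun q hq => ?_)
        ((Ideal.span_singleton_le_iff_mem _).2 (Ideal.mem_map_of_mem (ι.comp (algebraMap A B)) hc))
      exact Ideal.mem_span_singleton.2 (hdvd q hq)
    refine isDomain_and_isPrincipal_of_isPrime_span (hreg hs) htL hm hcreg
      ((IsLocalization.AtPrime.to_map_mem_maximal_iff _ P _).2 hc) ?_
    rw [← hspan, ← Ideal.Quotient.isDomain_iff_prime]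
    exact (IsRegularLocalRing.isDomain_and_exists_prime (LocalFibre (algebraMap A B) P)).1

/-- Let `A` be a reduced Noetherian ring, integrally closed in its total ring of fractions, and
`B` a flat Noetherian `A`-algebra with regular local fibres. Then `B` is integrally closed: a
fraction with denominator a non-zero-divisor which is integral over `B` lies in `B`. -/
theorem exists_algebraMap_eq_of_isIntegral_of_mul_eq (K : Type*) [CommRing K] [Algebra A K]
    [IsFractionRing A K] [IsIntegrallyClosedIn A K]
    (hfib : ∀ (P : Ideal B) [P.IsPrime], IsRegularLocalRing (LocalFibre (algebraMap A B) P))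
    {E : Type*} [CommRing E] [Algebra B E] (hE : Function.Injective (algebraMap B E))
    {z : E} (hz : IsIntegral B z) {s b : B} (hs : IsUnit (algebraMap B E s))
    (hzs : z * algebraMap B E s = algebraMap B E b) : ∃ c, algebraMap B E c = z := by
  have hsB : s ∈ B⁰ := mem_nonZeroDivisors_iff_right.2 fun a ha => hE (by
    rw [map_zero, ← hs.mul_left_eq_zero, ← map_mul, ha, map_zero])
  suffices s ∣ b by
    obtain ⟨c, rfl⟩ := this
    refine ⟨c, hs.mul_right_cancel ?_⟩
    rw [hzs, map_mul, mul_comm]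
  by_contra hsb
  obtain ⟨P, t, hP, ht, hPt, hbP⟩ := exists_isPrime_forall_mem_iff_dvd_mul hsb
  have := hfib P
  obtain ⟨hdom, hprin⟩ := isDomain_and_isPrincipal_localization (A := A) K hsB ht hPt
  have htfae : (maximalIdeal (Localization.AtPrime P)).IsPrincipal ↔
      IsPrincipalIdealRing (Localization.AtPrime P) :=
    (tfae_of_isNoetherianRing_of_isLocalRing_of_isDomain (Localization.AtPrime P)).out 4 0
  have := htfae.1 hprin
  have hint : IsIntegrallyClosed (Localization.AtPrime P) := inferInstance
  obtain ⟨f, hf, hfz⟩ := hz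
  -- Clearing denominators gives an equation for `b` inside `B`, which passes to `B_P` without a map
  -- out of `E`.
  have hroot : (f.scaleRoots s).eval b = 0 := by
    apply hE
    rw [map_zero, ← Polynomial.eval₂_at_apply, ← hzs, mul_comm]
    exact Polynomial.scaleRoots_eval₂_eq_zero _ hfz
  set ι := algebraMap B (Localization.AtPrime P) with hι
  let F := FractionRing (Localization.AtPrime P)
  let j : B →+* F := (algebraMap (Localization.AtPrime P) F).comp ι
  have hιs : ι s ≠ 0 := nonZeroDivisors.ne_zero
    (nonZeroDivisors_le_comap_of_flat B (Localization.AtPrime P) hsB)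
  have hjs : j s ≠ 0 := fun h => hιs (IsFractionRing.injective _ F (by rw [map_zero]; exact h))
  have hjint : IsIntegral (Localization.AtPrime P) (j b / j s) := by
    refine ⟨f.map ι, hf.map _, ?_⟩
    rw [Polynomial.eval₂_map]
    change f.eval₂ j _ = 0
    have h1 : (f.scaleRoots s).eval₂ j (j b) = 0 := by
      rw [Polynomial.eval₂_at_apply, hroot, map_zero]
    have h2 : j b = j s * (j b / j s) := (mul_div_cancel_of_imp' fun h => absurd h hjs).symm
    rw [h2, Polynomial.scaleRoots_eval₂_mul] at h1
    exact (mul_eq_zero.1 h1).resolve_left (pow_ne_zero _ hjs)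
  obtain ⟨c, hc⟩ := IsIntegrallyClosed.algebraMap_eq_of_integral hjint
  have hbc : ι b = ι s * c := by
    apply IsFractionRing.injective _ F
    rw [map_mul, hc]
    exact (mul_div_cancel_of_imp' fun h => absurd h hjs).symm
  obtain ⟨⟨d, m⟩, hd⟩ := IsLocalization.surj P.primeCompl c
  have h1 : ι (m * b) = ι (s * d) := by
    rw [map_mul, map_mul, hbc, hι, ← hd]; ring
  obtain ⟨n, hn⟩ := (IsLocalization.eq_iff_exists P.primeCompl _).1 h1
  have h2 : (n : B) * m ∈ P := hbP _ ⟨n * d, by linear_combination hn⟩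
  exact (hP.mem_or_mem h2).elim n.2 m.2

end LocalFibre

/-! ### Strict closure and base change -/

/-- Strict closures are preserved by isomorphisms. -/
theorem strictClosureIn_map_algEquiv {R A A' : Type*} [CommRing R] [CommRing A] [CommRing A']
    [Algebra R A] [Algebra R A'] (e : A ≃ₐ[R] A') :
    (strictClosureIn R A).map (e : A →ₐ[R] A') = strictClosureIn R A' := by
  apply le_antisymm
  · rintro _ ⟨α, hα, rfl⟩
    rw [mem_strictClosureIn_iff]
    simpa using congrArg (Algebra.TensorProduct.map (e : A →ₐ[R] A') (e : A →ₐ[R] A'))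
      ((mem_strictClosureIn_iff α).1 hα)
  · intro α hα
    refine ⟨e.symm α, ?_, by simp⟩
    refine (mem_strictClosureIn_iff _).2 ?_
    simpa using congrArg (Algebra.TensorProduct.map (e.symm : A' →ₐ[R] A) (e.symm : A' →ₐ[R] A))
      ((mem_strictClosureIn_iff α).1 hα)

/-- The strict closure commutes with flat base change. -/
theorem strictClosureIn_tensorProduct (R S A : Type*) [CommRing R] [CommRing S] [CommRing A]
    [Algebra R S] [Algebra R A] [Module.Flat R S] :
    strictClosureIn S (S ⊗[R] A) = (strictClosureIn R A).baseChange S := by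
  have hker : LinearMap.ker (Algebra.TensorProduct.includeLeftSubRight R A) =
      Subalgebra.toSubmodule (strictClosureIn R A) := by
    ext α
    rw [LinearMap.mem_ker, Algebra.TensorProduct.includeLeftSubRight_apply, sub_eq_zero]
    rfl
  have hex : Function.Exact (Subalgebra.toSubmodule (strictClosureIn R A)).subtype
      (Algebra.TensorProduct.includeLeftSubRight R A) := by
    rw [LinearMap.exact_iff, hker, Submodule.range_subtype]
  have hexS := Module.Flat.lTensor_exact S hex
  ext x
  -- Identify `S ⊗ (A ⊗ A)` with the tensor square of `S ⊗ A` over `S`; the defining difference map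
  -- is then a base change.
  rw [mem_strictClosureIn_iff, ← sub_eq_zero,
    ← Algebra.TensorProduct.includeLeftSubRight_apply,
    ← Algebra.TensorProduct.distribBaseChange_includeLeftSubRight_apply,
    LinearEquiv.map_eq_zero_iff]
  exact hexS x

theorem Subalgebra.baseChange_map {R A A' : Type*} (S : Type*) [CommRing R] [CommRing S]
    [CommRing A] [CommRing A'] [Algebra R S] [Algebra R A] [Algebra R A'] (f : A →ₐ[R] A')
    (C : Subalgebra R A) : (C.map f).baseChange S =
      (C.baseChange S).map (Algebra.TensorProduct.map (AlgHom.id S S) f) := by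
  apply le_antisymm
  · rintro _ ⟨y, rfl⟩
    induction y with
    | zero => rw [map_zero]; exact zero_mem _
    | add y z hy hz => rw [map_add]; exact add_mem hy hz
    | tmul s c =>
      obtain ⟨_, c, hc, rfl⟩ := c
      exact ⟨s ⊗ₜ c, Subalgebra.tmul_mem_baseChange hc s, by simp⟩
  · rintro _ ⟨_, ⟨y, rfl⟩, rfl⟩
    induction y with
    | zero => simp only [map_zero]; exact zero_mem _
    | add y z hy hz => simp only [map_add]; exact add_mem hy hz
    | tmul s c =>
      have h : f (c : A) ∈ C.map f := Subalgebra.mem_map.2 ⟨c, c.2, rfl⟩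
      exact Subalgebra.tmul_mem_baseChange h s

/-- Along a faithfully flat extension `S` of `R`, a subalgebra is `R` if and only if its base
change is `S`. -/
theorem Subalgebra.baseChange_eq_bot_iff {R A : Type*} (S : Type*) [CommRing R] [CommRing S]
    [CommRing A] [Algebra R S] [Algebra R A] [Module.FaithfullyFlat R S] (C : Subalgebra R A) :
    C.baseChange S = ⊥ ↔ C = ⊥ := by
  constructor
  · intro h
    have hinj : Function.Injective (Algebra.TensorProduct.map (AlgHom.id S S) C.val) :=
      Module.Flat.lTensor_preserves_injective_linearMap (M := S) C.val.toLinearMap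
        Subtype.val_injective
    have hsurj : Function.Surjective (algebraMap S (S ⊗[R] C)) := by
      intro y
      have hy : Algebra.TensorProduct.map (AlgHom.id S S) C.val y ∈ C.baseChange S := ⟨y, rfl⟩
      rw [h, Algebra.mem_bot] at hy
      obtain ⟨s, hs⟩ := hy
      exact ⟨s, hinj (by rw [AlgHom.commutes, hs])⟩
    rw [eq_bot_iff]
    intro c hc
    obtain ⟨r, hr⟩ := Module.FaithfullyFlat.surjective_of_tensorProduct hsurj ⟨c, hc⟩
    exact Algebra.mem_bot.2 ⟨r, congrArg Subtype.val hr⟩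
  · rintro rfl
    rw [eq_bot_iff]
    rintro _ ⟨y, rfl⟩
    induction y with
    | zero => rw [map_zero]; exact zero_mem _
    | add y z hy hz => rw [map_add]; exact add_mem hy hz
    | tmul s c =>
      obtain ⟨r, hr⟩ := Algebra.mem_bot.1 c.2
      refine Algebra.mem_bot.2 ⟨r • s, ?_⟩
      change _ = s ⊗ₜ[R] (c : A)
      rw [← hr, Algebra.TensorProduct.algebraMap_apply, Algebra.algebraMap_self, RingHom.id_apply,
        Algebra.algebraMap_eq_smul_one, TensorProduct.smul_tmul]

/-! ### Total rings of fractions and normalization -/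

/-- The total ring of fractions of a ring is that of each intermediate ring. -/
theorem isFractionRing_of_injective (R T K : Type*) [CommRing R] [CommRing T] [CommRing K]
    [Algebra R K] [Algebra R T] [Algebra T K] [IsScalarTower R T K] [IsFractionRing R K]
    (hT : Function.Injective (algebraMap T K)) : IsFractionRing T K where
  map_units := by
    rintro ⟨x, hx⟩
    obtain ⟨⟨r, u⟩, hru⟩ := IsLocalization.surj R⁰ (algebraMap T K x)
    have hr : r ∈ R⁰ := mem_nonZeroDivisors_iff_right.2 fun a ha => by
      have h0 : algebraMap R T a * x = 0 := by
        apply hT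
        rw [map_zero, ← (IsLocalization.map_units K u).mul_left_eq_zero, map_mul, mul_assoc, hru,
          ← IsScalarTower.algebraMap_apply, ← map_mul, ha, map_zero]
      have h1 := mem_nonZeroDivisors_iff_right.1 hx _ h0
      apply IsFractionRing.injective R K
      rw [map_zero, IsScalarTower.algebraMap_apply R T K, h1, map_zero]
    exact isUnit_of_mul_isUnit_left (hru ▸ IsLocalization.map_units K (⟨r, hr⟩ : R⁰))
  surj z := by
    obtain ⟨⟨r, u⟩, h⟩ := IsLocalization.surj R⁰ z
    rw [IsScalarTower.algebraMap_apply R T K, IsScalarTower.algebraMap_apply R T K] at h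
    refine ⟨⟨algebraMap R T r, ⟨algebraMap R T u, ?_⟩⟩, h⟩
    refine mem_nonZeroDivisors_iff_right.2 fun a ha => hT ?_
    rw [map_zero, ← (IsLocalization.map_units K u).mul_left_eq_zero,
      IsScalarTower.algebraMap_apply R T K, ← map_mul, ha, map_zero]
  exists_of_eq h := ⟨1, by rw [hT h]⟩

/-- The source is the localization of `S` at the image of `R⁰`, so any element is, up to a unit, in
the image of `S`, which embeds in `Q(S)`. -/
theorem tensorFractionRingMap_injective (R S : Type*) [CommRing R] [CommRing S] [Algebra R S]
    [Module.Flat R S] : Function.Injective (tensorFractionRingMap R S) := by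
  rw [injective_iff_map_eq_zero]
  intro x hx
  obtain ⟨⟨s, m⟩, h⟩ := IsLocalization.surj (Algebra.algebraMapSubmonoid S R⁰) x
  have hs : algebraMap S (FractionRing S) s = 0 := by
    have := congrArg (tensorFractionRingMap R S) h
    rw [map_mul, hx, zero_mul, AlgHom.commutes] at this
    exact this.symm
  have hs0 : s = 0 := IsFractionRing.injective S (FractionRing S) (by rw [hs, map_zero])
  have hu := IsLocalization.map_units (S ⊗[R] FractionRing R) m
  rw [← hu.mul_left_eq_zero, h, hs0, map_zero]

section Normalization

variable (R : Type u) (S : Type v) [CommRing R] [CommRing S] [Algebra R S]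

/-- The canonical map from the base change of the normalization of `R` to the total ring of
fractions of `S`. -/
noncomputable def tensorNormalizationMap [Module.Flat R S] :
    S ⊗[R] normalization R →ₐ[S] FractionRing S :=
  (tensorFractionRingMap R S).comp
    (Algebra.TensorProduct.map (AlgHom.id S S) (normalization R).val)

theorem tensorNormalizationMap_injective [Module.Flat R S] :
    Function.Injective (tensorNormalizationMap R S) :=
  (tensorFractionRingMap_injective R S).comp
    (Module.Flat.lTensor_preserves_injective_linearMap (M := S)
      (normalization R).val.toLinearMap Subtype.val_injective)

theorem range_tensorNormalizationMap [Module.Flat R S] :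
    (tensorNormalizationMap R S).range =
      ((normalization R).baseChange S).map (tensorFractionRingMap R S) :=
  AlgHom.range_comp _ _

/-- If the base change of the normalization of `R` is the normalization of `S`, then the same holds
for the strict closures. -/
theorem map_baseChange_strictClosure [Module.Flat R S]
    (h : (tensorNormalizationMap R S).range = normalization S) :
    ((strictClosure R).baseChange S).map (tensorFractionRingMap R S) = strictClosure S ∧
      (IsStrictlyClosed S ↔ (strictClosureIn R (normalization R)).baseChange S = ⊥) := by
  let e : S ⊗[R] normalization R ≃ₐ[S] normalization S :=
    (AlgEquiv.ofInjective _ (tensorNormalizationMap_injective R S)).trans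
      (Subalgebra.equivOfEq _ _ h)
  have he : (normalization S).val.comp (e : S ⊗[R] normalization R →ₐ[S] normalization S) =
      tensorNormalizationMap R S := AlgHom.ext fun _ => rfl
  have hS : strictClosureIn S (normalization S) =
      ((strictClosureIn R (normalization R)).baseChange S).map
        (e : S ⊗[R] normalization R →ₐ[S] normalization S) := by
    rw [← strictClosureIn_tensorProduct, strictClosureIn_map_algEquiv]
  constructor
  · rw [strictClosure, strictClosure, hS, Subalgebra.baseChange_map, Subalgebra.map_map,
      Subalgebra.map_map, he]
    rfl
  · rw [IsStrictlyClosed, IsStrictlyClosedIn, hS, ← Algebra.map_bot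
      (e : S ⊗[R] normalization R →ₐ[S] normalization S)]
    exact (Subalgebra.map_injective e.injective).eq_iff

end Normalization

/-- Let `A` be a finite `R`-algebra identified with the normalization of `R` by `φ`. If the local
fibres of `A → S ⊗[R] A` are regular, then `S ⊗[R] A` is reduced, and identified with the
normalization of `S`. -/
theorem isReduced_and_range_eq_normalization {R A : Type*} (S : Type*) [CommRing R] [CommRing S]
    [CommRing A] [Algebra R S] [Algebra R A] [IsNoetherianRing R] [IsNoetherianRing S]
    [Module.Flat R S] [IsReduced R] [Module.Finite R A] (φ : A →ₐ[R] FractionRing R)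
    (hφ : Function.Injective φ) (hrange : φ.range = normalization R)
    (hfib : ∀ (P : Ideal (S ⊗[R] A)) [P.IsPrime], IsRegularLocalRing
      (LocalFibre (Algebra.TensorProduct.includeRight : A →ₐ[R] S ⊗[R] A).toRingHom P)) :
    IsReduced (S ⊗[R] A) ∧ ((tensorFractionRingMap R S).comp
      (Algebra.TensorProduct.map (AlgHom.id S S) φ)).range = normalization S := by
  let : Algebra A (S ⊗[R] A) := Algebra.TensorProduct.rightAlgebra
  have : Module.Flat A (S ⊗[R] A) :=
    Module.Flat.of_linearEquiv (Algebra.TensorProduct.commRight R A S).symm.toLinearEquiv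
  have : IsNoetherianRing A := IsNoetherianRing.of_finite R _
  have : IsNoetherianRing (S ⊗[R] A) := IsNoetherianRing.of_finite S _
  have : IsReduced A := isReduced_of_injective φ hφ
  let : Algebra A (FractionRing R) := φ.toRingHom.toAlgebra
  have : IsScalarTower R A (FractionRing R) :=
    IsScalarTower.of_algebraMap_eq fun r => (φ.commutes r).symm
  have := isFractionRing_of_injective R A (FractionRing R) hφ
  have : IsIntegrallyClosedIn A (FractionRing R) := by
    refine isIntegrallyClosedIn_iff.2 ⟨hφ, fun {z} hz => ?_⟩
    have hzR : z ∈ normalization R := isIntegral_trans (R := R) z hz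
    rw [← hrange] at hzR
    exact hzR
  have hfib' : ∀ (P : Ideal (S ⊗[R] A)) [P.IsPrime],
      IsRegularLocalRing (LocalFibre (algebraMap A (S ⊗[R] A)) P) := hfib
  refine ⟨isReduced_of_isRegularLocalRing_localFibre hfib', le_antisymm ?_ fun z hz => ?_⟩
  · rintro _ ⟨y, rfl⟩
    exact (Algebra.IsIntegral.isIntegral (R := S) y).map ((tensorFractionRingMap R S).comp
      (Algebra.TensorProduct.map (AlgHom.id S S) φ))
  set γ := (tensorFractionRingMap R S).comp (Algebra.TensorProduct.map (AlgHom.id S S) φ) with hγ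
  have hγinj : Function.Injective γ := (tensorFractionRingMap_injective R S).comp
    (Module.Flat.lTensor_preserves_injective_linearMap (M := S) φ.toLinearMap hφ)
  let : Algebra (S ⊗[R] A) (FractionRing S) := γ.toRingHom.toAlgebra
  have : IsScalarTower S (S ⊗[R] A) (FractionRing S) :=
    IsScalarTower.of_algebraMap_eq fun s => (γ.commutes s).symm
  -- Numerator and denominator come from `S`, so `Q(S)` need not be known to be the total ring of
  -- fractions of `S ⊗[R] A`.
  obtain ⟨⟨a, s⟩, has⟩ := IsLocalization.surj S⁰ z
  rw [IsScalarTower.algebraMap_apply S (S ⊗[R] A) (FractionRing S),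
    IsScalarTower.algebraMap_apply S (S ⊗[R] A) (FractionRing S)] at has
  refine exists_algebraMap_eq_of_isIntegral_of_mul_eq (FractionRing R) hfib'
    hγinj (IsIntegral.tower_top hz) ?_ has
  rw [← IsScalarTower.algebraMap_apply]
  exact IsLocalization.map_units _ s

theorem theorem3p1 {R : Type u} {S : Type v} [CommRing R] [CommRing S]
    [IsNoetherianRing R] [IsNoetherianRing S] [Algebra R S] [Module.FaithfullyFlat R S]
    (hfib : ∀ (R' : Type u) [CommRing R'] [Algebra R R'] [Module.Finite R R']
      (P : Ideal (S ⊗[R] R')) [P.IsPrime],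
      IsRegularLocalRing
        (LocalFibre (Algebra.TensorProduct.includeRight : R' →ₐ[R] S ⊗[R] R').toRingHom P))
    [IsReduced R] [Module.Finite R (normalization R)] :
    IsReduced S ∧
    Function.Injective (tensorFractionRingMap R S) ∧
    ((normalization R).baseChange S).map (tensorFractionRingMap R S) = normalization S ∧
    ((strictClosure R).baseChange S).map (tensorFractionRingMap R S) = strictClosure S ∧
    (IsStrictlyClosed R ↔ IsStrictlyClosed S) := by
  obtain ⟨hred, hrange⟩ := isReduced_and_range_eq_normalization S (normalization R).val
    Subtype.val_injective (normalization R).range_val (hfib (normalization R))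
  obtain ⟨hstrict, hclosed⟩ := map_baseChange_strictClosure R S hrange
  refine ⟨?_, tensorFractionRingMap_injective R S, ?_, hstrict, ?_⟩
  -- `S` embeds in the reduced ring `S ⊗[R] normalization R`, through which its embedding in `Q(S)`
  -- factors.
  · have hinj : Function.Injective (algebraMap S (FractionRing S)) :=
      IsFractionRing.injective S (FractionRing S)
    refine isReduced_of_injective (algebraMap S (S ⊗[R] normalization R)) ?_
    rw [← (tensorNormalizationMap R S).comp_algebraMap, RingHom.coe_comp] at hinj
    exact hinj.of_comp
  · rw [← range_tensorNormalizationMap]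
    exact hrange
  · exact (hclosed.trans
      (Subalgebra.baseChange_eq_bot_iff S (strictClosureIn R (normalization R)))).symm
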